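/- A semi-Markovian graph (SMG) $G$ on a finite set $V$ of observed vertices consists of an acyclic set of directed edges $v\to w$ together with bidirected edges $v\leftrightarrow w$ between distinct vertices. For $K\subseteq V$, $G[K]$ is the induced subgraph (directed and bidirected edges), and $\mathrm{An}(K)_G$ is $K$ together with its ancestors. $\mathrm{Co}(K)_G$ is the set of vertices joined to $K$ by a path of directed or bidirected edges whose orientation is ignored, including $K$. $G_{\overline X}$ is $G$ with every edge having an arrowhead into $X$ removed (so bidirected edges at $X$ are removed too). The latent projection $L(G,K)$ is the SMG on $K$ in which $v\to w$ if and only if $G$ has a directed path from $v$ to $w$ with all intermediate vertices in $V\setminus K$, and, for $v\ne w$, $v\leftrightarrow w$ if and only if $G$ has a collider-free path between $v$ and $w$ with all intermediate vertices in $V\setminus K$ whose end edges have arrowheads into $v$ and into $w$. A causal model inducing $G$ has nonempty countable domains for the observed variables, finitely many mutually independent exogenous variables, and for each $v\in V$ a function giving the value of $v$ from its parents in $G$ and its exogenous parents, such that $v\leftrightarrow w$ in $G$ exactly when $v\neq w$ have a common exogenous parent. (Thus $G$ is the latent projection of the causal diagram; semi-Markovian models are those in which each exogenous variable has at most two children.)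 $P(V)$ is the law of the observed variables, and $P_x(y)$ is the probability of $Y=y$ after the functions of the variables in $X$ have been replaced by the constants $x$. The effect $P_x(y)$ is identifiable in $G$ if any two causal models inducing $G$ with the same domains and the same positive $P(V)$ have the same $P_x(y)$ for all $x,y$. **Corollary.** Let $G$ be an SMG on $V$, let $X,Y\subseteq V$ be disjoint, and let $Z=\mathrm{An}(Y)_G\setminus \mathrm{Co}(Y)_{G_{\overline X}}$. If $G[V\setminus Z]=L(G,V\setminus Z)$, then $Z$ can be removed from $G$ when the causal effect $P_x(y)$ is considered, that is, $P_x(y)$ obtained from $P$ in $G$ equals $P'_{x\setminus z}(y)$ obtained from $P'=P(V\setminus Z)$ in $G[V\setminus Z]$, where $x\setminus z$ is the restriction of $x$ to $X\setminus Z$. Precisely, $Y\cap Z=\emptyset$ and: 1. For every causal model inducing $G$, with observed distribution $P$ and causal effect $P_x(y)$, there is a causal model inducing $G[V\setminus Z]$ over the same domains with observed distribution $P'=P(V\setminus Z)$ and with $P'_{x\setminus z}(y)=P_x(y)$ for all $x,y$. 2. $P_x(y)$ is identifiable in $G$ if and only if $P'_{x\setminus z}(y)$ is identifiable in $G[V\setminus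 Z]$. 3. If these effects are identifiable, then for every causal model inducing $G$ and every causal model inducing $G[V\setminus Z]$ over the same domains whose observed distribution $P'$ is positive and equals $P(V\setminus Z)$, one has $P_x(y)=P'_{x\setminus z}(y)$ for all $x,y$. -/

import Mathlib

open MeasureTheory
open scoped ENNReal

universe u

/-- A semi-Markovian graph on the observed vertices `V`: directed edges `dir v w` (`v → w`) forming
an acyclic graph, together with bidirected edges `bi v w` (`v ↔ w`) between distinct vertices. -/
structure SMG (V : Type u) where
  dir : V → V → Prop
  bi : V → V → Prop
  acyclic : ∀ v, ¬ Relation.TransGen dir v v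
  bi_symm : ∀ v w, bi v w → bi w v
  bi_irrefl : ∀ v, ¬ bi v v

namespace SMG

variable {V : Type u}

/-- `An(W)`: the vertices of `W` and their ancestors. -/
def An (G : SMG V) (W : Set V) : Set V :=
  {v | ∃ w ∈ W, Relation.ReflTransGen G.dir v w}

/-- Two vertices are adjacent if some edge joins them, whatever its kind or direction. -/
def Adj (G : SMG V) (v w : V) : Prop :=
  G.dir v w ∨ G.dir w v ∨ G.bi v w

/-- `Co(W)`: the vertices connected to `W` by a path on which the directionality of the edges is
ignored, including `W` itself. -/
def Co (G : SMG V) (W : Set V) : Set V :=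
  {v | ∃ w ∈ W, Relation.ReflTransGen G.Adj w v}

/-- The graph obtained from `G` by removing all edges with an arrowhead into `X`: the directed
edges into `X` and the bidirected edges having an endpoint in `X`. -/
def removeIncoming (G : SMG V) (X : Set V) : SMG V where
  dir v w := G.dir v w ∧ w ∉ X
  bi v w := G.bi v w ∧ v ∉ X ∧ w ∉ X
  acyclic v h := G.acyclic v (h.lift id fun _ _ h' => h'.1)
  bi_symm v w h := ⟨G.bi_symm v w h.1, h.2.2, h.2.1⟩
  bi_irrefl v h := G.bi_irrefl v h.1

/-- The induced subgraph `G[K]`; it retains all directed and bidirected edges inside `K`. -/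
def induce (G : SMG V) (K : Set V) : SMG K where
  dir v w := G.dir v w
  bi v w := G.bi v w
  acyclic v h := G.acyclic v (h.lift Subtype.val fun _ _ h' => h')
  bi_symm v w h := G.bi_symm v w h
  bi_irrefl v h := G.bi_irrefl v h

/-- `G.DirPath L a b`: there is a directed path `a → ⋯ → b`, with at least one edge, all of whose
intermediate vertices lie in `L`. -/
inductive DirPath (G : SMG V) (L : Set V) : V → V → Prop
  | edge {a b : V} : G.dir a b → DirPath G L a b
  | cons {a c b : V} : G.dir a c → c ∈ L → DirPath G L c b → DirPath G L a b

/-- The way in which an edge is traversed along a path: `a → b`, `a ← b` or `a ↔ b`. -/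
inductive Mark
  | fwd
  | bwd
  | bid

/-- There is an edge between `a` and `b` which reads as the given mark when going from `a`
to `b`. -/
def Edge (G : SMG V) : Mark → V → V → Prop
  | .fwd, a, b => G.dir a b
  | .bwd, a, b => G.dir b a
  | .bid, a, b => G.bi a b

/-- The edge has an arrowhead at the vertex from which it is traversed. -/
def Mark.headAtStart : Mark → Prop
  | .fwd => False
  | .bwd => True
  | .bid => True

/-- The edge has an arrowhead at the vertex to which it is traversed. -/
def Mark.headAtEnd : Mark → Prop
  | .fwd => True
  | .bwd => False
  | .bid => True

/-- `G.NoColliderPath L m a b l`: there is a path from `a` to `b` without colliders, all of whose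
intermediate vertices lie in `L`, whose first edge is traversed as `m` and whose last edge is
traversed as `l`. Repetitions of vertices are harmless: when `a` and `b` are distinct and not in
`L`, a path with arrowheads at both ends may be shortened to one without repetitions. -/
inductive NoColliderPath (G : SMG V) (L : Set V) : Mark → V → V → Mark → Prop
  | edge {m : Mark} {a b : V} : G.Edge m a b → NoColliderPath G L m a b m
  | cons {m m' l : Mark} {a c b : V} : G.Edge m a c → c ∈ L →
      ¬ (m.headAtEnd ∧ m'.headAtStart) →
      NoColliderPath G L m' c b l → NoColliderPath G L m a b l

theorem DirPath.transGen {G : SMG V} {L : Set V} {a b : V} (h : G.DirPath L a b) :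
    Relation.TransGen G.dir a b := by
  induction h with
  | edge h => exact .single h
  | cons h _ _ ih => exact .head h ih

/-- Reversal of the mark of an edge. -/
def Mark.flip : Mark → Mark
  | .fwd => .bwd
  | .bwd => .fwd
  | .bid => .bid

theorem Mark.headAtStart_flip (m : Mark) : m.flip.headAtStart ↔ m.headAtEnd := by
  cases m <;> simp [Mark.flip, Mark.headAtStart, Mark.headAtEnd]

theorem Mark.headAtEnd_flip (m : Mark) : m.flip.headAtEnd ↔ m.headAtStart := by
  cases m <;> simp [Mark.flip, Mark.headAtStart, Mark.headAtEnd]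

theorem Edge.flip {G : SMG V} {m : Mark} {a b : V} (h : G.Edge m a b) : G.Edge m.flip b a := by
  cases m
  · exact h
  · exact h
  · exact G.bi_symm _ _ h

theorem NoColliderPath.snoc {G : SMG V} {L : Set V} {m l l' : Mark} {a c b : V}
    (h : G.NoColliderPath L m a c l) (hc : c ∈ L) (hl : ¬ (l.headAtEnd ∧ l'.headAtStart))
    (he : G.Edge l' c b) : G.NoColliderPath L m a b l' := by
  induction h with
  | edge h => exact .cons h hc hl (.edge he)
  | cons h hd hn _ ih => exact .cons h hd hn (ih hc hl he)

theorem NoColliderPath.reverse {G : SMG V} {L : Set V} {m l : Mark} {a b : V}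
    (h : G.NoColliderPath L m a b l) : G.NoColliderPath L l.flip b a m.flip := by
  induction h with
  | edge h => exact .edge h.flip
  | cons h hc hn _ ih =>
    refine ih.snoc hc ?_ h.flip
    rw [Mark.headAtEnd_flip, Mark.headAtStart_flip]
    exact fun h' => hn ⟨h'.2, h'.1⟩

/-- The latent projection `L(G, K)`: the vertices outside `K` are treated as latent (a bidirected
edge of `G` stands for a further latent vertex with two children). There is an edge `v → w` if
there is a directed path from `v` to `w` through latent vertices, and for distinct `v`, `w` an edge
`v ↔ w` if there is a path between them through latent vertices that has no collider, and whose
first and last edges have arrowheads into `v` and into `w`. -/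
def latentProjection (G : SMG V) (K : Set V) : SMG K where
  dir v w := G.DirPath Kᶜ v w
  bi v w := v ≠ w ∧ ∃ m l : Mark, m.headAtStart ∧ l.headAtEnd ∧ G.NoColliderPath Kᶜ m v w l
  acyclic v h := by
    have h' : Relation.TransGen (Relation.TransGen G.dir) (v : V) v :=
      h.lift Subtype.val fun _ _ hp => hp.transGen
    rw [Relation.transGen_eq_self] at h'
    exact G.acyclic v h'
  bi_symm v w h := by
    obtain ⟨hne, m, l, hm, hl, hp⟩ := h
    exact ⟨hne.symm, l.flip, m.flip, (Mark.headAtStart_flip l).2 hl,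
      (Mark.headAtEnd_flip m).2 hm, hp.reverse⟩
  bi_irrefl v h := h.1 rfl

theorem wellFounded_dir [Finite V] (G : SMG V) : WellFounded G.dir := by
  have : Std.Irrefl (Relation.TransGen G.dir) := ⟨G.acyclic⟩
  have h : WellFounded (Relation.TransGen G.dir) := Finite.wellFounded_of_trans_of_irrefl _
  exact Subrelation.wf (fun h' => Relation.TransGen.single h') h

end SMG

/-- A probabilistic causal model with mutually independent exogenous variables that induces the
semi-Markovian graph `G` and whose observed variables have the domains `D v`.

`ι` indexes the exogenous variables; `child i` is the set of observed variables whose functions are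
defined in terms of the `i`-th one. The function of `v` takes as arguments the observed parents of
`v` in `G` and the exogenous variables of which `v` is a child. The last field says that `v ↔ w` is
an edge of `G` exactly if `v` and `w` have a common exogenous parent, i.e. that `G` is the latent
projection of the causal diagram of the model to the observed variables. -/
structure CausalModel {V : Type u} (G : SMG V) (D : V → Type) where
  ι : Type u
  [fintypeIndex : Fintype ι]
  child : ι → Set V
  Ω : ι → Type
  [measurableSpaceΩ : ∀ i, MeasurableSpace (Ω i)]
  law : ∀ i, Measure (Ω i)
  [isProbabilityMeasure_law : ∀ i, IsProbabilityMeasure (law i)]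
  f : ∀ v, (∀ p : {p // G.dir p v}, D p) → (∀ i : {i // v ∈ child i}, Ω i) → D v
  measurable_f : ∀ v pa d, MeasurableSet {ω | f v pa ω = d}
  bi_iff : ∀ v w, v ≠ w → (G.bi v w ↔ ∃ i, v ∈ child i ∧ w ∈ child i)

namespace CausalModel

attribute [instance] fintypeIndex measurableSpaceΩ isProbabilityMeasure_law

variable {V : Type u} {G : SMG V} {D : V → Type}

/-- The joint law of the (mutually independent) exogenous variables. -/
noncomputable def exoLaw (M : CausalModel G D) : Measure (∀ i, M.Ω i) :=
  Measure.pi M.law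

open Classical in
/-- The values of the observed variables in the submodel `M_x`, in which the functions of the
variables in `X` are replaced by the constants `x v` (only the values of `x` on `X` are used), for
the value `ω` of the exogenous variables. -/
noncomputable def value [Finite V] (M : CausalModel G D) (X : Set V) (x : ∀ v, D v)
    (ω : ∀ i, M.Ω i) : ∀ v, D v :=
  G.wellFounded_dir.fix fun v ih =>
    if v ∈ X then x v else M.f v (fun p => ih p p.2) (fun i => ω i)

open Classical in
theorem value_eq [Finite V] (M : CausalModel G D) (X : Set V) (x : ∀ v, D v)
    (ω : ∀ i, M.Ω i) (v : V) :
    M.value X x ω v =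
      if v ∈ X then x v else M.f v (fun p => M.value X x ω p) (fun i => ω i) := by
  unfold value
  rw [WellFounded.fix_eq]

/-- The causal effect `P_x(y)`: the probability that `Y = y` in the submodel `M_x`. Only the values
of `x` on `X` and those of `y` on `Y` are used. -/
noncomputable def effect [Finite V] (M : CausalModel G D) (X : Set V) (x : ∀ v, D v)
    (Y : Set V) (y : ∀ v, D v) : ℝ≥0∞ :=
  M.exoLaw {ω | ∀ v ∈ Y, M.value X x ω v = y v}

/-- The observational probability `P(S = s)`: no variable is intervened on, so that the first `s`
below plays no role. -/
noncomputable def prob [Finite V] (M : CausalModel G D) (S : Set V) (s : ∀ v, D v) : ℝ≥0∞ :=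
  M.effect ∅ s S s

end CausalModel

namespace SMG

variable {V : Type u}

/-- The causal effect of `X` on `Y` is identifiable in `G`: it is determined by the (positive)
joint distribution `P(V)` of the observed variables in all causal models that induce `G`. -/
def Identifiable [Finite V] (G : SMG V) (X Y : Set V) : Prop :=
  ∀ (D : V → Type) [∀ v, Countable (D v)] [∀ v, Nonempty (D v)] (M₁ M₂ : CausalModel G D),
    (∀ s, M₁.prob Set.univ s = M₂.prob Set.univ s) → (∀ s, 0 < M₁.prob Set.univ s) →
    ∀ x y, M₁.effect X x Y y = M₂.effect X x Y y

/-- `Z` can be removed from `G` when the causal effect `P_x(y)` is considered: `P_x(y)` obtained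
from `P` in `G` is the same as `P'_{x ∖ z}(y)` obtained from `P' = P(V ∖ Z)` in `G[V ∖ Z]`. -/
def CanBeRemoved [Finite V] (G : SMG V) (X Y Z : Set V) : Prop :=
  Y ⊆ Zᶜ ∧
  -- every model of `G` has a counterpart inducing `G[V ∖ Z]`, with observed distribution
  -- `P' = P(V ∖ Z)` and the same causal effect
  (∀ (D : V → Type) [∀ v, Countable (D v)] [∀ v, Nonempty (D v)] (M : CausalModel G D),
    ∃ M' : CausalModel (G.induce Zᶜ) (fun k => D k),
      (∀ s : ∀ v, D v, M'.prob Set.univ (fun k => s k) = M.prob Zᶜ s) ∧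
      ∀ x y : ∀ v, D v,
        M.effect X x Y y =
          M'.effect (Subtype.val ⁻¹' X) (fun k => x k) (Subtype.val ⁻¹' Y) (fun k => y k)) ∧
  -- the effect is identifiable from `P` in `G` if and only if it is from `P'` in `G[V ∖ Z]`
  (G.Identifiable X Y ↔
    (G.induce Zᶜ).Identifiable (Subtype.val ⁻¹' X) (Subtype.val ⁻¹' Y)) ∧
  -- if so, the effect obtained from `P'` in `G[V ∖ Z]` is the one obtained from `P` in `G`
  (G.Identifiable X Y →
    ∀ (D : V → Type) [∀ v, Countable (D v)] [∀ v, Nonempty (D v)] (M : CausalModel G D)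
      (M' : CausalModel (G.induce Zᶜ) (fun k => D k)),
      (∀ s : ∀ v, D v, M'.prob Set.univ (fun k => s k) = M.prob Zᶜ s) →
      (∀ s, 0 < M'.prob Set.univ s) →
      ∀ x y : ∀ v, D v,
        M.effect X x Y y =
          M'.effect (Subtype.val ⁻¹' X) (fun k => x k) (Subtype.val ⁻¹' Y) (fun k => y k))

end SMG

/-! ### Collider-free paths through latent vertices. -/

namespace SMG

variable {V : Type u}

/-! Put `K = Zᶜ`. Ancestors of `Y` in `G_X̄` are connected to `Y` there, so they lie in `K`; hence
interventions outside `K` do not affect `Y` (`value_inter`). Models are then moved both ways between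
`G` and `G[K]`. Downwards (`project`), the functions of the variables outside `K` are substituted
into the others. The result induces `L(G, K) = G[K]`, with the marginal of `P` on `K` and the same
effect on `Y`. This gives claim 1, and identifiability passes from `G[K]` to `G`. Upwards
(`extend`), the variables outside `K` become independent noise of full support that `K` ignores.
Then `P` is `P'` times a positive factor independent of the model, so identifiability passes from
`G` to `G[K]` (`Identifiable.induce`). For claim 3, the projection of the model of `G` is compared
with the given model of `G[K]`. -/

theorem DirPath.noColliderPath {G : SMG V} {L : Set V} {a b : V} (h : G.DirPath L a b) :
    G.NoColliderPath L .fwd a b .fwd := by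
  induction h with
  | edge h => exact .edge h
  | cons h hc _ ih => exact .cons (m := .fwd) (m' := .fwd) h hc (fun h' => h'.2) ih

/-- The reversed path has a tail at `u` and at each of its intermediate vertices, so no junction is
a collider, whatever the mark `m`. -/
theorem DirPath.reverse_append {G : SMG V} {L : Set V} {u v w : V} {m l : Mark}
    (h : G.DirPath L u v) (hu : u ∈ L) (hp : G.NoColliderPath L m u w l) :
    G.NoColliderPath L .bwd v w l := by
  induction h generalizing m with
  | edge h => exact .cons (m := .bwd) h hu (fun h' => h'.1) hp
  | cons h hc _ ih => exact ih hc (.cons (m := .bwd) h hu (fun h' => h'.1) hp)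

/-- `u` is `v`, or a latent ancestor of `v` along a path of latent vertices. -/
def LatentSource (G : SMG V) (K : Set V) (u v : V) : Prop :=
  u = v ∨ u ∉ K ∧ G.DirPath Kᶜ u v

/-- The path is `v ← ⋯ ← a ↔ b → ⋯ → w`, where either arm may be trivial, and `a`, `b` may coincide
at a latent vertex. -/
theorem latentProjection_bi_of_latentSource {G : SMG V} {K : Set V} {v w : K} {a b : V}
    (hvw : v ≠ w) (hab : a = b ∨ G.bi a b) (ha : G.LatentSource K a v)
    (hb : G.LatentSource K b w) : (G.latentProjection K).bi v w := by
  refine ⟨hvw, ?_⟩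
  rcases ha with rfl | ⟨haK, ha⟩ <;> rcases hb with rfl | ⟨hbK, hb⟩
  · rcases hab with hab | hab
    · exact absurd (Subtype.ext hab) hvw
    · exact ⟨.bid, .bid, trivial, trivial, .edge hab⟩
  · rcases hab with rfl | hab
    · exact absurd v.2 hbK
    · exact ⟨.bid, .fwd, trivial, trivial,
        .cons (m := .bid) (m' := .fwd) hab hbK (fun h => h.2) hb.noColliderPath⟩
  · rcases hab with rfl | hab
    · exact absurd w.2 haK
    · exact ⟨.bwd, .bid, trivial, trivial, ha.reverse_append haK (.edge (m := .bid) hab)⟩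
  · rcases hab with rfl | hab
    · exact ⟨.bwd, .fwd, trivial, trivial, ha.reverse_append haK hb.noColliderPath⟩
    · exact ⟨.bwd, .fwd, trivial, trivial, ha.reverse_append haK
        (.cons (m := .bid) (m' := .fwd) hab hbK (fun h => h.2) hb.noColliderPath)⟩

/-- Apart from the hypothesis on the latent projection, this is all that the argument needs to know
about `Z`. -/
theorem An_removeIncoming_subset_Co (G : SMG V) (X Y : Set V) :
    (G.removeIncoming X).An Y ⊆ (G.removeIncoming X).Co Y := by
  rintro v ⟨w, hw, h⟩
  refine ⟨w, hw, ?_⟩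
  induction h using Relation.ReflTransGen.head_induction_on with
  | refl => exact .refl
  | head h _ ih => exact ih.tail (Or.inr (Or.inl h))

/-- The bidirected edges with a first endpoint outside `K`, and a loop for every vertex
outside `K`. -/
abbrev OuterEdge (G : SMG V) (K : Set V) : Type u :=
  {q : V × V // q.1 ∉ K ∧ (q.1 = q.2 ∨ G.bi q.1 q.2)}

noncomputable instance [Finite V] (G : SMG V) (K : Set V) : Fintype (G.OuterEdge K) :=
  Fintype.ofFinite _

/-- The loop at a vertex outside `K`. -/
def OuterEdge.loop {G : SMG V} {K : Set V} {v : V} (h : v ∉ K) : G.OuterEdge K :=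
  ⟨(v, v), h, Or.inl rfl⟩

end SMG

/-! ### Ingredients of the projected and extended models. -/

namespace CausalModel

variable {V : Type u} {G : SMG V} {D : V → Type}

open Classical in
/-- Arbitrary extension of values of the `G[K]`-parents of `v`. -/
noncomputable def extendParents [∀ v, Nonempty (D v)] (K : Set V) (v : K)
    (pa : ∀ p : {p // (G.induce K).dir p v}, D p) (u : V) : D u :=
  if h : ∃ hu : u ∈ K, (G.induce K).dir ⟨u, hu⟩ v then pa ⟨⟨u, h.1⟩, h.2⟩
  else Classical.arbitrary _

theorem extendParents_apply [∀ v, Nonempty (D v)] {K : Set V} {v : K}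
    (pa : ∀ p : {p // (G.induce K).dir p v}, D p) (p : K) (h : (G.induce K).dir p v) :
    extendParents K v pa p = pa ⟨p, h⟩ :=
  dif_pos (⟨p.2, h⟩ : ∃ hu : (p : V) ∈ K, (G.induce K).dir ⟨p, hu⟩ v)

open Classical in
/-- Arbitrary extension of the values of some of the exogenous variables. -/
noncomputable def extendExo (M : CausalModel G D) {C : M.ι → Prop} (ω : ∀ i : {i // C i}, M.Ω i)
    (i : M.ι) : M.Ω i :=
  if h : C i then ω ⟨i, h⟩ else (nonempty_of_isProbabilityMeasure (M.law i)).some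

theorem extendExo_apply (M : CausalModel G D) {C : M.ι → Prop} (ω : ∀ i : {i // C i}, M.Ω i)
    {i : M.ι} (h : C i) : M.extendExo ω i = ω ⟨i, h⟩ :=
  dif_pos h

variable {K : Set V}

/-- The domain of the noise variable attached to an edge, or loop, starting outside `K`. -/
def Noise (D : V → Type) (q : G.OuterEdge K) : Type := D q.1.1

instance (q : G.OuterEdge K) : MeasurableSpace (Noise D q) := ⊤

/-- The law of the noise variable attached to an edge, or loop, starting outside `K`. -/
noncomputable def noiseLaw (p : ∀ v, v ∉ K → PMF (D v)) (q : G.OuterEdge K) :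
    Measure (Noise D q) :=
  @PMF.toMeasure _ ⊤ (p q.1.1 q.2.1)

instance (p : ∀ v, v ∉ K → PMF (D v)) (q : G.OuterEdge K) :
    IsProbabilityMeasure (noiseLaw p q) :=
  @PMF.toMeasure.isProbabilityMeasure _ ⊤ (p q.1.1 q.2.1)

theorem noiseLaw_singleton (p : ∀ v, v ∉ K → PMF (D v)) (q : G.OuterEdge K) (d : Noise D q) :
    noiseLaw p q {d} = p q.1.1 q.2.1 d :=
  @PMF.toMeasure_apply_singleton _ ⊤ (p q.1.1 q.2.1) d trivial

theorem measurable_extendExo (M : CausalModel G D) {C : M.ι → Prop} :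
    Measurable (M.extendExo (C := C)) := by
  refine measurable_pi_iff.2 fun i => ?_
  by_cases h : C i
  · simp only [M.extendExo_apply _ h]
    exact measurable_pi_apply _
  · simp only [extendExo, dif_neg h]
    exact measurable_const

/-- The exogenous arguments of the extension of a model over `K`. -/
abbrev extendChild (M : CausalModel (G.induce K) (fun k => D k)) :
    M.ι ⊕ G.OuterEdge K → Set V :=
  Sum.elim (fun i => Subtype.val '' M.child i) (fun q => {q.1.1, q.1.2})

open Classical in
/-- The functions of the extension of a model over `K`. -/
noncomputable def extendFun (M : CausalModel (G.induce K) (fun k => D k)) (v : V)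
    (pa : ∀ p : {p // G.dir p v}, D p)
    (ω : ∀ i : {i // v ∈ M.extendChild i}, Sum.elim M.Ω (Noise D) i.1) : D v :=
  if h : v ∈ K then M.f ⟨v, h⟩ (fun p => pa ⟨p, p.2⟩)
    (fun i => ω ⟨.inl i, ⟨v, h⟩, i.2, rfl⟩)
  -- Only the noise at loops is ever read; the noise at proper edges serves to realize the
  -- bidirected edges that leave `K`.
  else ω ⟨.inr (.loop h), Or.inl rfl⟩

instance (M : CausalModel (G.induce K) (fun k => D k)) :
    ∀ i, MeasurableSpace (Sum.elim M.Ω (Noise (G := G) (K := K) D) i)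
  | .inl i => inferInstanceAs (MeasurableSpace (M.Ω i))
  | .inr q => inferInstanceAs (MeasurableSpace (Noise D q))

/-- The laws of the exogenous variables of the extension of a model over `K`. -/
noncomputable def extendLaw (M : CausalModel (G.induce K) (fun k => D k))
    (p : ∀ v, v ∉ K → PMF (D v)) :
    ∀ i : M.ι ⊕ G.OuterEdge K, Measure (Sum.elim M.Ω (Noise D) i)
  | .inl i => M.law i
  | .inr q => noiseLaw p q

instance (M : CausalModel (G.induce K) (fun k => D k)) (p : ∀ v, v ∉ K → PMF (D v)) :
    ∀ i, IsProbabilityMeasure (M.extendLaw p i)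
  | .inl i => inferInstanceAs (IsProbabilityMeasure (M.law i))
  | .inr q => inferInstanceAs (IsProbabilityMeasure (noiseLaw p q))

theorem measurableSet_extendFun_eq (M : CausalModel (G.induce K) (fun k => D k)) (v : V)
    (pa : ∀ p : {p // G.dir p v}, D p) (d : D v) :
    MeasurableSet {ω | M.extendFun v pa ω = d} := by
  by_cases h : v ∈ K
  · have : Measurable fun (ω : ∀ i : {i // v ∈ M.extendChild i}, Sum.elim M.Ω (Noise D) i.1)
        (i : {i // (⟨v, h⟩ : K) ∈ M.child i}) => (ω ⟨.inl i, ⟨v, h⟩, i.2, rfl⟩ : M.Ω i) :=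
      measurable_pi_iff.2 fun i =>
        measurable_pi_apply (⟨.inl i, ⟨v, h⟩, i.2, rfl⟩ : {i // v ∈ M.extendChild i})
    convert this (M.measurable_f ⟨v, h⟩ (fun p => pa ⟨p, p.2⟩) d) using 1
    ext ω
    exact Eq.congr_left (dif_pos h)
  · have : Measurable fun ω : ∀ i : {i // v ∈ M.extendChild i}, Sum.elim M.Ω (Noise D) i.1 =>
        (ω ⟨.inr (.loop h), Or.inl rfl⟩ : Noise D (.loop h : G.OuterEdge K)) :=
      measurable_pi_apply (⟨.inr (.loop h), Or.inl rfl⟩ : {i // v ∈ M.extendChild i})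
    convert this (t := {(d : Noise D (.loop h : G.OuterEdge K))}) trivial using 1
    ext ω
    exact Eq.congr_left (dif_neg h)

/-! ### Solving the functional equations; measurability and marginals. -/

variable [Finite V]

/-- The values in a submodel are determined, on a set of vertices closed under taking parents up
to the intervened variables, by the functional equations. -/
theorem value_eq_of_equations (M : CausalModel G D) {X : Set V} {x : ∀ v, D v}
    {ω : ∀ i, M.Ω i} (g : ∀ v, D v) (S : Set V)
    (h : ∀ v ∈ S, (v ∈ X ∧ g v = x v) ∨ (v ∉ X ∧ (∀ p, G.dir p v → p ∈ S) ∧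
      g v = M.f v (fun p => g p) (fun i => ω i))) :
    ∀ v ∈ S, M.value X x ω v = g v := by
  intro v
  induction v using G.wellFounded_dir.induction with
  | _ v ih =>
    intro hv
    rw [value_eq]
    rcases h v hv with ⟨hX, hg⟩ | ⟨hX, hp, hg⟩
    · rw [if_pos hX, hg]
    · rw [if_neg hX, hg]
      congr 1
      funext p
      exact ih p p.2 (hp p p.2)

theorem value_of_mem (M : CausalModel G D) {X : Set V} (x : ∀ v, D v) (ω : ∀ i, M.Ω i) {v : V}
    (hv : v ∈ X) : M.value X x ω v = x v := by
  rw [value_eq, if_pos hv]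

theorem value_of_notMem (M : CausalModel G D) {X : Set V} (x : ∀ v, D v) (ω : ∀ i, M.Ω i) {v : V}
    (hv : v ∉ X) :
    M.value X x ω v = M.f v (fun p => M.value X x ω p) (fun i => ω i) := by
  rw [value_eq, if_neg hv]

/-- By induction along the graph: finitely many parents with countable domains make the event a
countable union over the values of the parents. -/
theorem measurableSet_value_eq [∀ v, Countable (D v)] (M : CausalModel G D) (X : Set V)
    (x : ∀ v, D v) (v : V) (d : D v) : MeasurableSet {ω | M.value X x ω v = d} := by
  induction v using G.wellFounded_dir.induction with
  | _ v ih =>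
    by_cases hv : v ∈ X
    · simp only [M.value_of_mem x _ hv, MeasurableSet.const]
    · have : {ω | M.value X x ω v = d} = ⋃ pa : (∀ p : {p // G.dir p v}, D p),
          (⋂ p : {p // G.dir p v}, {ω | M.value X x ω p = pa p}) ∩
            (fun ω (i : {i // v ∈ M.child i}) => ω i) ⁻¹' {ω | M.f v pa ω = d} := by
        ext ω
        simp only [Set.mem_ofPred_eq, Set.mem_iUnion, Set.mem_inter_iff, Set.mem_iInter,
          Set.mem_preimage, M.value_of_notMem x ω hv]
        constructor
        · exact fun h => ⟨_, fun _ => rfl, h⟩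
        · rintro ⟨pa, h, rfl⟩
          congr 1
          exact funext h
      rw [this]
      refine .iUnion fun pa => .inter (.iInter fun p => ih p p.2 _) ?_
      exact (measurable_pi_iff.2 fun i => measurable_pi_apply _) (M.measurable_f v pa d)

/-- An intervention outside `K` has no effect on `Y`, if `K` contains the ancestors of `Y` in
the graph in which the edges into `X` have been removed. -/
theorem value_inter (M : CausalModel G D) {X Y K : Set V} (hK : (G.removeIncoming X).An Y ⊆ K)
    (x : ∀ v, D v) (ω : ∀ i, M.Ω i) {v : V} (hv : v ∈ Y) :
    M.value X x ω v = M.value (X ∩ K) x ω v := by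
  refine M.value_eq_of_equations _ ((G.removeIncoming X).An Y) (fun u hu => ?_) v ⟨v, hv, .refl⟩
  by_cases huX : u ∈ X
  · exact Or.inl ⟨huX, M.value_of_mem _ _ ⟨huX, hK hu⟩⟩
  · refine Or.inr ⟨huX, fun p hp => ?_, M.value_of_notMem _ _ fun h => huX h.1⟩
    obtain ⟨w, hw, h⟩ := hu
    exact ⟨w, hw, h.head ⟨hp, huX⟩⟩

/-- The marginal of the observed distribution is obtained by summation. -/
theorem prob_eq_tsum [∀ v, Countable (D v)] (M : CausalModel G D) (K : Set V) (s : ∀ v, D v) :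
    M.prob K s = ∑' t : {t : ∀ v, D v | ∀ v ∈ K, t v = s v}, M.prob Set.univ t := by
  -- The events for different `t` formally carry different interventional values, which are
  -- irrelevant for the empty intervention.
  have hval : ∀ (x x' : ∀ v, D v) ω, M.value ∅ x ω = M.value ∅ x' ω := fun x x' ω => by
    funext v
    refine M.value_eq_of_equations _ Set.univ (fun v _ => Or.inr ⟨id, fun _ _ => trivial, ?_⟩) v
      trivial
    exact M.value_of_notMem x' ω id
  have hset : {ω | ∀ v ∈ K, M.value ∅ s ω v = s v} =
      ⋃ t ∈ {t : ∀ v, D v | ∀ v ∈ K, t v = s v}, {ω | ∀ v ∈ Set.univ, M.value ∅ t ω v = t v} := by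
    ext ω
    simp only [Set.mem_ofPred_eq, Set.mem_iUnion, exists_prop, Set.mem_univ, true_imp_iff]
    constructor
    · exact fun h => ⟨M.value ∅ s ω, h, fun v => congrFun (hval _ _ ω) v⟩
    · rintro ⟨t, ht, h⟩ v hv
      rw [hval s t, h, ht v hv]
  unfold prob effect
  rw [hset, measure_biUnion (Set.to_countable _)]
  · intro t _ t' _ htt'
    refine Set.disjoint_left.2 fun ω h h' => htt' (funext fun v => ?_)
    rw [← h v trivial, ← h' v trivial, hval]
  · intro t _
    simp only [Set.mem_univ, true_imp_iff, Set.ofPred_forall]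
    exact .iInter fun v => M.measurableSet_value_eq _ _ _ _

theorem prob_univ_le (M : CausalModel G D) (K : Set V) (s : ∀ v, D v) :
    M.prob Set.univ s ≤ M.prob K s :=
  measure_mono fun _ h v _ => h v trivial

/-! ### Eliminating the variables outside `K`. -/

section Projection

/-- The model over `K` obtained by substituting the functions of the variables outside `K`, when
the latent projection to `K` is the induced subgraph. -/
noncomputable def project [∀ v, Countable (D v)] [∀ v, Nonempty (D v)] (M : CausalModel G D)
    (K : Set V) (hL : G.induce K = G.latentProjection K) :
    CausalModel (G.induce K) (fun k => D k) where
  ι := M.ι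
  child i := {v | ∃ u ∈ M.child i, G.LatentSource K u v}
  Ω := M.Ω
  law := M.law
  -- Fixing all of `K` except `v` confines the recursion to `v` and its latent ancestors; the
  -- default values in both extensions are then never read.
  f v pa ω := M.value (K \ {(v : V)}) (extendParents K v pa) (M.extendExo ω) v
  measurable_f v pa d := M.measurable_extendExo (M.measurableSet_value_eq _ _ _ d)
  bi_iff v w hvw := by
    constructor
    · intro h
      obtain ⟨i, hv, hw⟩ := (M.bi_iff v w fun h' => hvw (Subtype.ext h')).1 h
      exact ⟨i, ⟨v, hv, Or.inl rfl⟩, ⟨w, hw, Or.inl rfl⟩⟩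
    · rintro ⟨i, ⟨a, ha, hav⟩, ⟨b, hb, hbw⟩⟩
      -- Elimination could create new bidirected edges; `hL` says that none arise.
      rw [hL]
      refine SMG.latentProjection_bi_of_latentSource hvw ?_ hav hbw
      by_cases hab : a = b
      · exact Or.inl hab
      · exact Or.inr ((M.bi_iff a b hab).2 ⟨i, ha, hb⟩)

variable [∀ v, Countable (D v)] [∀ v, Nonempty (D v)]

/-- Uniqueness of solutions is used twice: for the equations of the projected model, and inside each
of its functions, where `K \ {v}` is held fixed. -/
theorem value_project (M : CausalModel G D) {K : Set V}
    (hL : G.induce K = G.latentProjection K) (X : Set V) (x : ∀ v, D v) (ω : ∀ i, M.Ω i) (v : K) :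
    (M.project K hL).value (Subtype.val ⁻¹' X) (fun k => x k) ω v = M.value (X ∩ K) x ω v := by
  have hdir : ∀ p w : K, G.DirPath Kᶜ p w → (G.induce K).dir p w := fun p w h => by
    rw [hL]; exact h
  refine (M.project K hL).value_eq_of_equations (fun k => M.value (X ∩ K) x ω k) Set.univ
    (fun v _ => ?_) v trivial
  by_cases hv : (v : V) ∈ X
  · exact Or.inl ⟨hv, M.value_of_mem _ _ ⟨hv, v.2⟩⟩
  refine Or.inr ⟨hv, fun _ _ => trivial, Eq.symm ?_⟩
  have hnoise : ∀ u, G.LatentSource K u v →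
      (fun i : {i // u ∈ M.child i} => ω i) = fun i : {i // u ∈ M.child i} => M.extendExo
        (C := fun i => ∃ a ∈ M.child i, G.LatentSource K a v) (fun i => ω i) i := fun u hu => by
    funext i
    exact (M.extendExo_apply (C := fun i => ∃ a ∈ M.child i, G.LatentSource K a v)
      (fun i => ω i) ⟨u, i.2, hu⟩).symm
  -- A parent of a latent source is again a latent source if it lies outside `K`; otherwise a
  -- directed latent path joins it to `v`, which by `hL` makes it a `G[K]`-parent, held fixed.
  refine M.value_eq_of_equations (M.value (X ∩ K) x ω)
    {u | G.LatentSource K u v ∨ ∃ hu : u ∈ K, (G.induce K).dir ⟨u, hu⟩ v} ?_ v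
    (Or.inl (Or.inl rfl))
  rintro u (hu | ⟨hu, huv⟩)
  · have hparents : ∀ p, G.dir p u → G.DirPath Kᶜ p v := fun p hp => by
      rcases hu with rfl | ⟨huK, hu⟩
      · exact .edge hp
      · exact .cons hp huK hu
    refine Or.inr ⟨?_, fun p hp => ?_, ?_⟩
    · rintro ⟨huK, huv⟩
      rcases hu with hu | hu
      · exact huv hu
      · exact hu.1 huK
    · by_cases hpK : p ∈ K
      · exact Or.inr ⟨hpK, hdir ⟨p, hpK⟩ v (hparents p hp)⟩
      · exact Or.inl (Or.inr ⟨hpK, hparents p hp⟩)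
    · refine (M.value_of_notMem _ _ ?_).trans (congrArg (M.f u _) (hnoise u hu))
      rintro ⟨huX, huK⟩
      rcases hu with rfl | hu
      · exact hv huX
      · exact hu.1 huK
  · refine Or.inl ⟨⟨hu, ?_⟩, ?_⟩
    · rintro rfl
      exact G.acyclic _ (.single huv)
    · exact (extendParents_apply (fun p => M.value (X ∩ K) x ω p.1) ⟨u, hu⟩ huv).symm

theorem prob_project (M : CausalModel G D) {K : Set V}
    (hL : G.induce K = G.latentProjection K) (s : ∀ v, D v) :
    (M.project K hL).prob Set.univ (fun k => s k) = M.prob K s := by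
  refine congrArg M.exoLaw (Set.ext fun ω => ?_)
  have h := M.value_project hL ∅ s ω
  rw [Set.empty_inter, Set.preimage_empty] at h
  exact ⟨fun h' v hv => (h ⟨v, hv⟩).symm.trans (h' ⟨v, hv⟩ trivial),
    fun h' v _ => (h v).trans (h' v v.2)⟩

/-- Interventions outside `K` cannot be expressed in `G[K]`; on `Y` they are discarded by
`value_inter`. -/
theorem effect_project (M : CausalModel G D) {X Y K : Set V}
    (hL : G.induce K = G.latentProjection K) (hK : (G.removeIncoming X).An Y ⊆ K)
    (x y : ∀ v, D v) :
    M.effect X x Y y = (M.project K hL).effect (Subtype.val ⁻¹' X) (fun k => x k)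
      (Subtype.val ⁻¹' Y) (fun k => y k) := by
  refine congrArg M.exoLaw (Set.ext fun ω => ?_)
  have h : ∀ v : K, (v : V) ∈ Y → (M.project K hL).value (Subtype.val ⁻¹' X) (fun k => x k) ω v =
      M.value X x ω v := fun v hv => by
    rw [M.value_inter hK x ω hv]
    exact M.value_project hL X x ω v
  exact ⟨fun h' v hv => (h v hv).trans (h' v hv),
    fun h' v hv => (h ⟨v, hK ⟨v, hv, .refl⟩⟩ hv).symm.trans (h' ⟨v, _⟩ hv)⟩

end Projection

/-! ### Adding independent noise outside `K`. -/

section Extension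

/-- Extension of a model over `K` to the whole graph, in which the variables outside `K` are
independent noise that is ignored by the variables in `K`. -/
noncomputable def extend (M : CausalModel (G.induce K) (fun k => D k))
    (p : ∀ v, v ∉ K → PMF (D v)) : CausalModel G D where
  ι := M.ι ⊕ G.OuterEdge K
  child := M.extendChild
  Ω := Sum.elim M.Ω (Noise D)
  law := M.extendLaw p
  f := M.extendFun
  measurable_f := M.measurableSet_extendFun_eq
  bi_iff v w hvw := by
    constructor
    · intro h
      by_cases hv : v ∈ K
      · by_cases hw : w ∈ K
        · obtain ⟨i, hi, hi'⟩ := (M.bi_iff ⟨v, hv⟩ ⟨w, hw⟩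
            fun h => hvw (congrArg Subtype.val h)).1 h
          exact ⟨.inl i, ⟨_, hi, rfl⟩, ⟨_, hi', rfl⟩⟩
        -- Outer edges are listed from an endpoint outside `K`, so the edge is reversed here.
        · exact ⟨.inr ⟨(w, v), hw, Or.inr (G.bi_symm _ _ h)⟩, Or.inr rfl, Or.inl rfl⟩
      · exact ⟨.inr ⟨(v, w), hv, Or.inr h⟩, Or.inl rfl, Or.inr rfl⟩
    · rintro ⟨i | ⟨⟨a, b⟩, ha, hab⟩, hv, hw⟩
      · obtain ⟨v, hv, rfl⟩ := hv
        obtain ⟨w, hw, rfl⟩ := hw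
        exact (M.bi_iff v w fun h => hvw (congrArg Subtype.val h)).2 ⟨i, hv, hw⟩
      · rcases hv with rfl | rfl <;> rcases hw with rfl | rfl
        · exact absurd rfl hvw
        · exact hab.resolve_left hvw
        · exact G.bi_symm _ _ (hab.resolve_left hvw.symm)
        · exact absurd rfl hvw

/-- Splitting the coordinates is a measurable equivalence, and the product formula for rectangles
needs no measurability of `A` and `B`. -/
theorem exoLaw_extend (M : CausalModel (G.induce K) (fun k => D k))
    (p : ∀ v, v ∉ K → PMF (D v)) (A : Set (∀ i, M.Ω i)) (B : Set (∀ q : G.OuterEdge K, Noise D q)) :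
    (M.extend p).exoLaw {ω | (fun i => ω (.inl i)) ∈ A ∧ (fun q => ω (.inr q)) ∈ B} =
      M.exoLaw A * Measure.pi (noiseLaw p) B := by
  refine ((measurePreserving_sumPiEquivProdPi (M.extendLaw p)).measure_preimage_equiv
    (A ×ˢ B)).trans ?_
  exact Measure.prod_prod (μ := M.exoLaw) (ν := Measure.pi (noiseLaw p)) A B

theorem value_extend (M : CausalModel (G.induce K) (fun k => D k))
    (p : ∀ v, v ∉ K → PMF (D v)) (X : Set V) (x : ∀ v, D v) (ω : ∀ i, (M.extend p).Ω i) (v : K) :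
    (M.extend p).value X x ω v =
      M.value (Subtype.val ⁻¹' X) (fun k => x k) (fun i => ω (.inl i)) v := by
  refine (M.value_eq_of_equations (fun k => (M.extend p).value X x ω k) Set.univ
    (fun v _ => ?_) v trivial).symm
  by_cases hv : (v : V) ∈ X
  · exact Or.inl ⟨hv, (M.extend p).value_of_mem _ _ hv⟩
  · exact Or.inr ⟨hv, fun _ _ => trivial, ((M.extend p).value_of_notMem _ _ hv).trans (dif_pos v.2)⟩

theorem effect_extend (M : CausalModel (G.induce K) (fun k => D k))
    (p : ∀ v, v ∉ K → PMF (D v)) (X : Set V) (x : ∀ v, D v) {Y : Set V} (hY : Y ⊆ K)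
    (y : ∀ v, D v) :
    (M.extend p).effect X x Y y = M.effect (Subtype.val ⁻¹' X) (fun k => x k)
      (Subtype.val ⁻¹' Y) (fun k => y k) := by
  refine Eq.trans ?_ ((M.exoLaw_extend p _ Set.univ).trans
    ((congrArg (_ * ·) measure_univ).trans (mul_one _)))
  refine congrArg (M.extend p).exoLaw (Set.ext fun ω => ?_)
  have h := M.value_extend p X x ω
  exact ⟨fun h' => ⟨fun v hv => (h v).symm.trans (h' v hv), trivial⟩,
    fun h' v hv => (h ⟨v, hY hv⟩).trans (h'.1 ⟨v, hY hv⟩ hv)⟩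

/-- The second factor does not involve `M`, so models with equal `P'` have extensions with equal
`P`. -/
theorem prob_extend (M : CausalModel (G.induce K) (fun k => D k))
    (p : ∀ v, v ∉ K → PMF (D v)) (s : ∀ v, D v) :
    (M.extend p).prob Set.univ s = M.prob Set.univ (fun k => s k) *
      Measure.pi (noiseLaw (G := G) p) {η | ∀ v (h : v ∉ K), η (.loop h) = s v} := by
  refine Eq.trans ?_ (M.exoLaw_extend p _ _)
  refine congrArg (M.extend p).exoLaw (Set.ext fun ω => ?_)
  have h := M.value_extend p ∅ s ω
  rw [Set.preimage_empty] at h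
  have h' : ∀ v (hv : v ∉ K), (M.extend p).value ∅ s ω v = ω (.inr (.loop hv)) := fun v hv =>
    ((M.extend p).value_of_notMem _ _ id).trans (dif_neg hv)
  constructor
  · exact fun hs => ⟨fun v _ => (h v).symm.trans (hs v trivial),
      fun v hv => (h' v hv).symm.trans (hs v trivial)⟩
  · rintro ⟨hs, hs'⟩ v -
    by_cases hv : v ∈ K
    · exact (h ⟨v, hv⟩).trans (hs ⟨v, hv⟩ trivial)
    · exact (h' v hv).trans (hs' v hv)

/-- The event contains a single point, obtained by giving each outer edge the value of `s` at its
first endpoint; its mass is a finite product of positive numbers. -/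
theorem pi_noiseLaw_pos (p : ∀ v, v ∉ K → PMF (D v)) (hp : ∀ v h d, p v h d ≠ 0)
    (s : ∀ v, D v) :
    0 < Measure.pi (noiseLaw (G := G) p) {η | ∀ v (h : v ∉ K), η (.loop h) = s v} := by
  have hsub : Set.univ.pi (fun q : G.OuterEdge K => ({(s q.1.1 : Noise D q)} : Set (Noise D q))) ⊆
      {η | ∀ v (h : v ∉ K), η (.loop h) = s v} := fun η hη v h => hη (.loop h) trivial
  refine lt_of_lt_of_le (pos_iff_ne_zero.2 ?_) (measure_mono hsub)
  rw [Measure.pi_pi]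
  refine Finset.prod_ne_zero_iff.2 fun q _ => ?_
  exact (noiseLaw_singleton p q _).trans_ne (hp _ _ _)

end Extension

end CausalModel

/-! ### Transfer of identifiability and the main theorem. -/

namespace SMG

theorem exists_extending {V : Type u} {D : V → Type} [∀ v, Nonempty (D v)] (K : Set V)
    (z : ∀ k : K, D k) : ∃ z' : ∀ v, D v, (fun k : K => z' k) = z := by
  classical
  exact ⟨fun v => if h : v ∈ K then z ⟨v, h⟩ else Classical.arbitrary _,
    funext fun k => dif_pos k.2⟩

/-- Domains for the vertices in `K` can be extended to all vertices, with a positive law on each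
of the new domains. -/
theorem exists_domains_extending {V : Type u} (K : Set V) (D' : K → Type) [∀ k, Countable (D' k)]
    [∀ k, Nonempty (D' k)] :
    ∃ D : V → Type, (fun k : K => D k) = D' ∧ (∀ v, Countable (D v)) ∧ (∀ v, Nonempty (D v)) ∧
      ∃ p : ∀ v, v ∉ K → PMF (D v), ∀ v h d, p v h d ≠ 0 := by
  classical
  -- Any nonempty countable domain would do in place of `Bool`; the uniform law has full support.
  let D : V → Type := fun v => if h : v ∈ K then D' ⟨v, h⟩ else Bool
  have h₁ : ∀ v (h : v ∈ K), D v = D' ⟨v, h⟩ := fun v h => dif_pos h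
  have h₂ : ∀ v, v ∉ K → D v = Bool := fun v h => dif_neg h
  refine ⟨D, funext fun k => h₁ k k.2, fun v => ?_, fun v => ?_, ?_⟩
  · by_cases h : v ∈ K
    · rw [h₁ v h]; infer_instance
    · rw [h₂ v h]; infer_instance
  · by_cases h : v ∈ K
    · rw [h₁ v h]; infer_instance
    · rw [h₂ v h]; infer_instance
  · have : ∀ v, v ∉ K → ∃ p : PMF (D v), ∀ d, p d ≠ 0 := fun v h => by
      rw [h₂ v h]
      exact ⟨PMF.uniformOfFintype Bool, fun d => by simp⟩
    choose p hp using this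
    exact ⟨p, hp⟩

variable {V : Type u} [Finite V] {G : SMG V} {X Y K : Set V}

/-- Identifiability is inherited by induced subgraphs. -/
theorem Identifiable.induce (h : G.Identifiable X Y) (hY : Y ⊆ K) :
    (G.induce K).Identifiable (Subtype.val ⁻¹' X) (Subtype.val ⁻¹' Y) := by
  intro D' _ _ M₁ M₂ hM hpos x y
  -- Replacing `D'` by the restriction of `D` lets `extend` apply without casts.
  obtain ⟨D, rfl, _, _, p, hp⟩ := exists_domains_extending K D'
  obtain ⟨x, rfl⟩ := exists_extending K x
  obtain ⟨y, rfl⟩ := exists_extending K y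
  rw [← M₁.effect_extend p X x hY y, ← M₂.effect_extend p X x hY y]
  refine h D _ _ (fun s => ?_) (fun s => ?_) x y
  · rw [M₁.prob_extend, M₂.prob_extend, hM]
  · rw [M₁.prob_extend]
    exact ENNReal.mul_pos (hpos _).ne' (CausalModel.pi_noiseLaw_pos p hp s).ne'

/-- Identifiability in a latent projection that is an induced subgraph implies identifiability. -/
theorem identifiable_of_induce (hL : G.induce K = G.latentProjection K)
    (hK : (G.removeIncoming X).An Y ⊆ K)
    (h : (G.induce K).Identifiable (Subtype.val ⁻¹' X) (Subtype.val ⁻¹' Y)) :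
    G.Identifiable X Y := by
  intro D _ _ M₁ M₂ hM hpos x y
  rw [M₁.effect_project hL hK, M₂.effect_project hL hK]
  refine h _ _ _ (fun s => ?_) (fun s => ?_) _ _
  · obtain ⟨s, rfl⟩ := exists_extending K s
    rw [M₁.prob_project, M₂.prob_project, M₁.prob_eq_tsum, M₂.prob_eq_tsum]
    simp only [hM]
  · obtain ⟨s, rfl⟩ := exists_extending K s
    rw [M₁.prob_project]
    exact (hpos s).trans_le (M₁.prob_univ_le K s)

end SMG

theorem mainTheorem3 {V : Type u} [Finite V] (G : SMG V) (X Y : Set V) (hXY : Disjoint X Y)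
    (Z : Set V) (hZ : Z = G.An Y \ (G.removeIncoming X).Co Y)
    (hL : G.induce Zᶜ = G.latentProjection Zᶜ) :
    G.CanBeRemoved X Y Z := by
  have hK : (G.removeIncoming X).An Y ⊆ Zᶜ := fun v hv hvZ => by
    rw [hZ] at hvZ
    exact hvZ.2 (G.An_removeIncoming_subset_Co X Y hv)
  have hY : Y ⊆ Zᶜ := fun v hv => hK ⟨v, hv, .refl⟩
  refine ⟨hY, ?_, ⟨fun h => h.induce hY, SMG.identifiable_of_induce hL hK⟩, ?_⟩
  · intro D _ _ M
    exact ⟨M.project Zᶜ hL, M.prob_project hL, M.effect_project hL hK⟩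
  · intro h D _ _ M M' hM hpos x y
    rw [M.effect_project hL hK]
    -- Identifiability is applied in `G[Zᶜ]`, because only `P'` is assumed positive; `P` itself may
    -- vanish somewhere.
    have hprob : ∀ s, (M.project Zᶜ hL).prob Set.univ s = M'.prob Set.univ s := fun s => by
      obtain ⟨s, rfl⟩ := SMG.exists_extending Zᶜ s
      rw [M.prob_project hL, hM]
    refine h.induce hY _ _ _ hprob (fun s => ?_) _ _
    rw [hprob]
    exact hpos s
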